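/- **Setting.** Let $\mathbb T^3=[0,1]^3$ be the flat torus, $T>0$, $\nu,\kappa>0$, $\gamma>1$, $p(s)=s^\gamma$, and let $H\in C([0,\infty))$ satisfy $H''(s)=p'(s)/s$ for $s>0$; put $H(s|r)=H(s)-H(r)-H'(r)(s-r)$. Write $(\nabla a)_{ij}=\partial_j a_i$, $\nabla^t a=(\nabla a)^t$, $(a\otimes b)_{ij}=a_ib_j$, $A:B=\sum_{i,j}A_{ij}B_{ij}$. **Weak solutions.** $(\varrho,v,w)$, with $\varrho\ge 0$ and $u=w-v$, is a weak solution on $[0,T]\times\mathbb T^3$ of the augmented Navier–Stokes–Korteweg system with viscosity $\mu(\varrho)=2\nu\varrho$ if the following holds. (a) $\varrho$, $\nabla\varrho$, $\nabla\sqrt\varrho$, $\varrho^{\gamma/2}$, $\sqrt\varrho\,v$, $\sqrt\varrho\,w$ are bounded on $[0,T]$ with values in $L^2(\mathbb T^3)$ (for representatives defined at every time), $\Delta\varrho\in L^2((0,T)\times\mathbb T^3)$, $\frac{p'(\varrho)}{\varrho}|\nabla\varrho|^2\in L^1((0,T)\times\mathbb T^3)$, and $v=2\nu\nabla\log\varrho$,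 that is $v=2\nu\,\nabla\varrho/\varrho$ a.e. on $\{\varrho>0\}$. (b) For $a=u,v,w$ there is a tensor field $\mathcal T(a)$ with $\sqrt\varrho\,\mathcal T(a)\in L^1((0,T)\times\mathbb T^3)$ and $\sqrt\varrho\,\mathcal T_{ij}(a)=\partial_j(\varrho a_i)-2\sqrt\varrho\,a_i\,\partial_j\sqrt\varrho$ in the sense of distributions. The symmetric part $\mathcal S(u)$ of $\mathcal T(u)$ and the anti-symmetric part $\mathcal A(w)$ of $\mathcal T(w)$ are in $L^2((0,T)\times\mathbb T^3)$. Below, $\varrho\nabla v$ and $\varrho\nabla w$ stand for $\sqrt\varrho\,\mathcal T(v)$ and $\sqrt\varrho\,\mathcal T(w)$. (c) For all $\tau\in[0,T]$ and all smooth $\varphi$ (scalar) and $\phi,\psi$ (with values in $\mathbb R^3$) on $[0,T]\times\mathbb T^3$, $$-\int_{\mathbb T^3}(\varrho\varphi)(\tau)\,dx+\int_{\mathbb T^3}(\varrho\varphi)(0)\,dx+\int_0^\tau\!\!\int_{\mathbb T^3}(\varrho\,\partial_t\varphi+\varrho u\cdot\nabla\varphi)\,dxdt=0,$$ $$-\int_{\mathbb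 T^3}(\varrho w\cdot\phi)(\tau)\,dx+\int_{\mathbb T^3}(\varrho w\cdot\phi)(0)\,dx+\int_0^\tau\!\!\int_{\mathbb T^3}\big(\varrho w\cdot\partial_t\phi+\varrho w\otimes u:\nabla\phi+p(\varrho)\,\mathrm{div}\,\phi-2\nu\varrho\nabla w:\nabla\phi+2\nu\varrho\nabla v:\nabla\phi\big)dxdt$$ $$+2\kappa^2\int_0^\tau\!\!\int_{\mathbb T^3}\big(\nabla\varrho\cdot\nabla(\varrho\,\mathrm{div}\,\phi)-\tfrac12|\nabla\varrho|^2\mathrm{div}\,\phi+\nabla\varrho\otimes\nabla\varrho:\nabla\phi\big)dxdt=0,$$ $$-\int_{\mathbb T^3}(\varrho v\cdot\psi)(\tau)\,dx+\int_{\mathbb T^3}(\varrho v\cdot\psi)(0)\,dx+\int_0^\tau\!\!\int_{\mathbb T^3}\big(\varrho v\cdot\partial_t\psi+\varrho v\otimes u:\nabla\psi-2\nu\varrho\nabla^tv:\nabla\psi+2\nu\varrho\nabla^tw:\nabla\psi\big)dxdt=0.$$ (d) With $E(t)=\int_{\mathbb T^3}\big(\tfrac12\varrho(|w|^2+|v|^2)+H(\varrho)+\kappa^2|\nabla\varrho|^2\big)(t,x)\,dx$,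 for all $\tau\in[0,T]$, $$E(\tau)+2\nu\int_0^\tau\!\!\int_{\mathbb T^3}\Big(|\mathcal S(u)|^2+|\mathcal A(w)|^2+\frac{p'(\varrho)}{\varrho}|\nabla\varrho|^2\Big)dxdt+4\nu\kappa^2\int_0^\tau\!\!\int_{\mathbb T^3}|\Delta\varrho|^2\,dxdt\le E(0).$$ **Theorem.** Let $(\varrho,v,w)$ be such a weak solution. For all smooth $r,W,V$ on $[0,T]\times\mathbb T^3$ with $r>0$ (and $W,V$ with values in $\mathbb R^3$), the relative entropy $$\mathcal E(t)=\int_{\mathbb T^3}\Big[\tfrac12\varrho\big(|w-W|^2+|v-V|^2\big)+\kappa^2|\nabla\varrho-\nabla r|^2\Big](t,x)\,dx+\int_{\mathbb T^3}H(\varrho|r)(t,x)\,dx$$ satisfies, for every $\tau\in[0,T]$ (in particular for $\tau=T$), $$\begin{aligned} \mathcal E(\tau)-\mathcal E(0)\le{}&\int_0^\tau\!\!\int_{\mathbb T^3}\varrho\big(\partial_tV\cdot(V-v)+(\nabla V\,u)\cdot(V-v)\big)dxdt+\int_0^\tau\!\!\int_{\mathbb T^3}\varrho\big(\partial_tW\cdot(W-w)+(\nabla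 W\,u)\cdot(W-w)\big)dxdt\\ &+2\kappa^2\int_0^\tau\!\!\int_{\mathbb T^3}\big(\varrho\,\partial_t\Delta r+\varrho u\cdot\nabla\Delta r-\partial_tr\,\Delta r\big)dxdt\\ &-2\kappa^2\int_0^\tau\!\!\int_{\mathbb T^3}\big(\nabla\varrho\cdot\nabla(\varrho\,\mathrm{div}\,W)-\tfrac12|\nabla\varrho|^2\,\mathrm{div}\,W+\nabla\varrho\otimes\nabla\varrho:\nabla W\big)dxdt\\ &+2\nu\int_0^\tau\!\!\int_{\mathbb T^3}\varrho\big(\nabla^tv:\nabla V+\nabla w:\nabla W\big)dxdt-2\nu\int_0^\tau\!\!\int_{\mathbb T^3}\varrho\big(\nabla v:\nabla W+\nabla^tw:\nabla V\big)dxdt\\ &-\int_0^\tau\!\!\int_{\mathbb T^3}\big[\partial_t(H'(r))(\varrho-r)+\varrho u\cdot\nabla(H'(r))+p(\varrho)\,\mathrm{div}\,W\big]dxdt\\ &-2\nu\int_0^\tau\!\!\int_{\mathbb T^3}\Big(|\mathcal S(u)|^2+|\mathcal A(w)|^2+\frac{p'(\varrho)}{\varrho}|\nabla\varrho|^2\Big)dxdt-4\nu\kappa^2\int_0^\tau\!\!\int_{\mathbb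 T^3}|\Delta\varrho|^2\,dxdt . \end{aligned}$$ -/

import Mathlib

open MeasureTheory Set
open scoped ContDiff Matrix

noncomputable section

namespace NSK

/-! ### The flat torus

Functions on the flat torus `[0,1]³` are functions on `ℝ³` that are `1`-periodic in every
coordinate; integrals over the torus are integrals over the unit cube. -/

/-- The space `ℝ³`. Only its Lebesgue measure and its differential structure are used;
Euclidean lengths and products are written with `⬝ᵥ`. -/
abbrev X : Type := Fin 3 → ℝ

/-- `3 × 3` real matrices. -/
abbrev Mat : Type := Matrix (Fin 3) (Fin 3) ℝ

/-- The unit cube, a fundamental domain of the torus. -/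
def cube : Set X := Icc 0 1

/-- Lebesgue measure on the torus. -/
def torusMeasure : Measure X := volume.restrict cube

/-- Lebesgue measure on `(0,T) × 𝕋³`. -/
def slab (T : ℝ) : Measure (ℝ × X) := (volume.restrict (Ioc 0 T)).prod torusMeasure

/-- The space integral `∫_{𝕋³} f dx`. -/
def spaceInt (f : X → ℝ) : ℝ := ∫ x, f x ∂torusMeasure

/-- The space-time integral `∫_0^τ ∫_{𝕋³} F dx dt`. -/
def stInt (τ : ℝ) (F : ℝ → X → ℝ) : ℝ := ∫ t in (0 : ℝ)..τ, spaceInt (F t)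

/-- `f` is `1`-periodic in every coordinate. -/
def Periodic {E : Type*} (f : X → E) : Prop :=
  ∀ (i : Fin 3) (x : X), f (x + Pi.single i 1) = f x

/-- Smooth functions of time and of the point of the torus (their restrictions to
`[0,T] × 𝕋³` are the functions that are smooth up to both end points). -/
structure Smooth {E : Type*} [NormedAddCommGroup E] [NormedSpace ℝ E] (φ : ℝ → X → E) : Prop where
  contDiff : ContDiff ℝ ∞ (fun z : ℝ × X => φ z.1 z.2)
  periodic : ∀ t, Periodic (φ t)

/-! ### Differential operators on smooth functions -/

/-- The partial derivative `∂_i f`. -/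
def pd (i : Fin 3) (f : X → ℝ) (x : X) : ℝ := fderiv ℝ f x (Pi.single i 1)

/-- The gradient `∇f`. -/
def grad (f : X → ℝ) (x : X) : X := fun i => pd i f x

/-- The Laplacian `Δf`. -/
def lap (f : X → ℝ) (x : X) : ℝ := ∑ i, pd i (pd i f) x

/-- The divergence `div F`. -/
def dvg (F : X → X) (x : X) : ℝ := ∑ i, pd i (fun y => F y i) x

/-- The gradient `∇F` of a vector field, `(∇F)_{ij} = ∂_j F_i`. -/
def jac (F : X → X) (x : X) : Mat := Matrix.of fun i j => pd j (fun y => F y i) x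

/-- The time derivative `∂_t φ`. -/
def dt {E : Type*} [NormedAddCommGroup E] [NormedSpace ℝ E] (φ : ℝ → X → E) (t : ℝ) (x : X) : E :=
  deriv (fun s => φ s x) t

/-! ### Linear algebra -/

/-- `|a|²`. -/
def sqn (a : X) : ℝ := a ⬝ᵥ a

/-- The contraction `A : B = ∑_{ij} A_{ij} B_{ij}`; `|A|² = A : A`. -/
def colon (A B : Mat) : ℝ := ∑ i, ∑ j, A i j * B i j

/-- The symmetric part of a matrix. -/
def symPart (A : Mat) : Mat := (1 / 2 : ℝ) • (A + Aᵀ)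

/-- The anti-symmetric part of a matrix. -/
def antiPart (A : Mat) : Mat := (1 / 2 : ℝ) • (A - Aᵀ)

/-! ### Weak derivatives and function classes -/

/-- `g` is the weak (distributional) gradient of `f` on the torus. -/
structure IsWeakGrad (f : X → ℝ) (g : X → X) : Prop where
  integrable : Integrable f torusMeasure
  integrable_grad : ∀ i, Integrable (fun x => g x i) torusMeasure
  weak : ∀ ξ : X → ℝ, ContDiff ℝ ∞ ξ → Periodic ξ → ∀ i,
    spaceInt (fun x => f x * pd i ξ x) = - spaceInt (fun x => g x i * ξ x)

/-- Boundedness in time with values in `L²(𝕋³)`, for the representative that is defined at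
every time of `[0,T]`. -/
def LinfL2 (T : ℝ) (F : ℝ → X → ℝ) : Prop :=
  ∃ C : ℝ, ∀ t ∈ Icc 0 T, MemLp (F t) 2 torusMeasure ∧ spaceInt (fun x => F t x ^ 2) ≤ C

/-- Joint measurability on `(0,T) × 𝕋³`. -/
def MeasOn (T : ℝ) (F : ℝ → X → ℝ) : Prop :=
  AEStronglyMeasurable (fun z : ℝ × X => F z.1 z.2) (slab T)

/-- Integrability on `(0,T) × 𝕋³`. -/
def IntegrableSlab (T : ℝ) (F : ℝ → X → ℝ) : Prop :=
  Integrable (fun z : ℝ × X => F z.1 z.2) (slab T)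

/-! ### Pressure -/

/-- The pressure law `p(s) = s^γ`. -/
def pressure (γ : ℝ) (s : ℝ) : ℝ := s ^ γ

/-- `H` is a pressure potential: `H'' (s) = p'(s) / s` for `s > 0`, continuous up to `s = 0`. -/
structure IsPressurePotential (γ : ℝ) (H : ℝ → ℝ) : Prop where
  continuousOn : ContinuousOn H (Ici 0)
  differentiableAt : ∀ s, 0 < s → DifferentiableAt ℝ H s
  second_deriv : ∀ s, 0 < s → HasDerivAt (deriv H) (deriv (pressure γ) s / s) s

/-- `H(s|r) = H(s) - H(r) - H'(r)(s - r)`. -/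
def relPotential (H : ℝ → ℝ) (s r : ℝ) : ℝ := H s - H r - deriv H r * (s - r)

/-! ### The augmented Navier-Stokes-Korteweg system -/

/-- The unknowns `(ρ,v,w)` of the augmented system together with representatives of the weak
derivatives `∇ρ`, `∇√ρ`, `Δρ` and of the tensors `𝒯(u)`, `𝒯(v)`, `𝒯(w)`, which stand for
`√ρ ∇u`, `√ρ ∇v`, `√ρ ∇w`. What ties them together is `IsWeakSolution`. -/
structure Fields where
  ρ : ℝ → X → ℝ
  v : ℝ → X → X
  w : ℝ → X → X
  gradρ : ℝ → X → X
  gradSqrtρ : ℝ → X → X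
  lapρ : ℝ → X → ℝ
  Tu : ℝ → X → Mat
  Tv : ℝ → X → Mat
  Tw : ℝ → X → Mat

namespace Fields

/-- The velocity `u`, from `w = u + v`. -/
def u (S : Fields) (t : ℝ) (x : X) : X := S.w t x - S.v t x

/-- `∇(ρ ψ) = ψ ∇ρ + ρ ∇ψ`, the weak gradient of the product of `ρ` and a smooth `ψ`. -/
def gradρMul (S : Fields) (ψ : ℝ → X → ℝ) (t : ℝ) (x : X) : X :=
  ψ t x • S.gradρ t x + S.ρ t x • grad (ψ t) x

/-- The capillary integrand
`∇ρ · ∇(ρ div φ) - ½ |∇ρ|² div φ + ∇ρ ⊗ ∇ρ : ∇φ`. -/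
def capillary (S : Fields) (φ : ℝ → X → X) (t : ℝ) (x : X) : ℝ :=
  S.gradρ t x ⬝ᵥ S.gradρMul (fun s => dvg (φ s)) t x
    - 1 / 2 * sqn (S.gradρ t x) * dvg (φ t) x
    + colon (Matrix.vecMulVec (S.gradρ t x) (S.gradρ t x)) (jac (φ t) x)

/-- The energy `∫ ½ρ(|w|² + |v|²) + H(ρ) + κ²|∇ρ|²` at time `t`. -/
def energy (κ : ℝ) (H : ℝ → ℝ) (S : Fields) (t : ℝ) : ℝ :=
  spaceInt fun x => 1 / 2 * S.ρ t x * (sqn (S.w t x) + sqn (S.v t x)) + H (S.ρ t x)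
    + κ ^ 2 * sqn (S.gradρ t x)

/-- The integrand `|𝒮(u)|² + |𝒜(w)|² + p'(ρ)/ρ |∇ρ|²`. -/
def viscousDissipation (γ : ℝ) (S : Fields) (t : ℝ) (x : X) : ℝ :=
  colon (symPart (S.Tu t x)) (symPart (S.Tu t x))
    + colon (antiPart (S.Tw t x)) (antiPart (S.Tw t x))
    + deriv (pressure γ) (S.ρ t x) / S.ρ t x * sqn (S.gradρ t x)

/-- The relative entropy
`∫ ½ρ(|w-W|² + |v-V|²) + κ²|∇ρ-∇r|² dx + ∫ H(ρ|r) dx` at time `t`. -/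
def relEntropy (κ : ℝ) (H : ℝ → ℝ) (S : Fields) (r : ℝ → X → ℝ) (W V : ℝ → X → X) (t : ℝ) : ℝ :=
  spaceInt (fun x =>
      1 / 2 * S.ρ t x * (sqn (S.w t x - W t x) + sqn (S.v t x - V t x))
        + κ ^ 2 * sqn (S.gradρ t x - grad (r t) x))
    + spaceInt (fun x => relPotential H (S.ρ t x) (r t x))

end Fields

/-- `𝒯` is the tensor `𝒯(a)` attached to the density `ρ` and the velocity `a`:
`√ρ 𝒯_{ij} = ∂_j (ρ a_i) - 2 (√ρ a_i) ∂_j √ρ` in the sense of distributions on `(0,T) × 𝕋³`. -/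
structure IsTensorOf (T : ℝ) (ρ : ℝ → X → ℝ) (gradSqrtρ : ℝ → X → X) (a : ℝ → X → X)
    (𝒯 : ℝ → X → Mat) : Prop where
  periodic : ∀ t, Periodic (𝒯 t)
  meas : ∀ i j, MeasOn T (fun t x => 𝒯 t x i j)
  integrable : ∀ i j, IntegrableSlab T (fun t x => √(ρ t x) * 𝒯 t x i j)
  weak : ∀ ξ : ℝ → X → ℝ, Smooth ξ → ∀ i j,
    stInt T (fun t x => √(ρ t x) * 𝒯 t x i j * ξ t x)
      = - stInt T (fun t x => ρ t x * a t x i * pd j (ξ t) x)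
        - stInt T (fun t x => 2 * (√(ρ t x) * a t x i) * gradSqrtρ t x j * ξ t x)

/-- Weak solutions on `[0,T] × 𝕋³` of the augmented system
`∂ₜρ + div(ρu) = 0`,
`∂ₜ(ρw) + div(ρw⊗u) + ∇p(ρ) - 2ν div(ρ∇w) + 2ν div(ρ∇v)
  - 2κ²(∇(ρΔρ) + ½∇|∇ρ|² - 4 div(ρ∇√ρ⊗∇√ρ)) = 0`,
`∂ₜ(ρv) + div(ρv⊗u) + 2ν div(ρ∇ᵗu) = 0`,
where `v = 2ν∇log ρ` and `w = u + v`. The viscous quantities `ρ∇v`, `ρ∇w` are `√ρ 𝒯(v)`,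
`√ρ 𝒯(w)`. -/
structure IsWeakSolution (ν κ γ : ℝ) (H : ℝ → ℝ) (T : ℝ) (S : Fields) : Prop where
  -- periodicity
  periodic_ρ : ∀ t, Periodic (S.ρ t)
  periodic_v : ∀ t, Periodic (S.v t)
  periodic_w : ∀ t, Periodic (S.w t)
  periodic_gradρ : ∀ t, Periodic (S.gradρ t)
  periodic_gradSqrtρ : ∀ t, Periodic (S.gradSqrtρ t)
  periodic_lapρ : ∀ t, Periodic (S.lapρ t)
  -- measurability in time and space
  meas_ρ : MeasOn T S.ρ
  meas_v : ∀ i, MeasOn T (fun t x => S.v t x i)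
  meas_w : ∀ i, MeasOn T (fun t x => S.w t x i)
  meas_gradρ : ∀ i, MeasOn T (fun t x => S.gradρ t x i)
  meas_gradSqrtρ : ∀ i, MeasOn T (fun t x => S.gradSqrtρ t x i)
  meas_lapρ : MeasOn T S.lapρ
  -- integrability
  nonneg : ∀ t ∈ Icc 0 T, ∀ᵐ x ∂torusMeasure, 0 ≤ S.ρ t x
  bound_ρ : LinfL2 T S.ρ
  bound_gradρ : ∀ i, LinfL2 T (fun t x => S.gradρ t x i)
  bound_gradSqrtρ : ∀ i, LinfL2 T (fun t x => S.gradSqrtρ t x i)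
  bound_pressure : LinfL2 T (fun t x => S.ρ t x ^ (γ / 2))
  bound_v : ∀ i, LinfL2 T (fun t x => √(S.ρ t x) * S.v t x i)
  bound_w : ∀ i, LinfL2 T (fun t x => √(S.ρ t x) * S.w t x i)
  integrable_symPart : IntegrableSlab T
    (fun t x => colon (symPart (S.Tu t x)) (symPart (S.Tu t x)))
  integrable_antiPart : IntegrableSlab T
    (fun t x => colon (antiPart (S.Tw t x)) (antiPart (S.Tw t x)))
  integrable_pressure : IntegrableSlab T
    (fun t x => deriv (pressure γ) (S.ρ t x) / S.ρ t x * sqn (S.gradρ t x))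
  integrable_lapρ : IntegrableSlab T (fun t x => S.lapρ t x ^ 2)
  -- the weak derivatives, the relation `v = 2ν∇log ρ`, and the tensors
  weakGrad : ∀ t ∈ Icc 0 T, IsWeakGrad (S.ρ t) (S.gradρ t)
  weakGrad_sqrt : ∀ t ∈ Icc 0 T, IsWeakGrad (fun x => √(S.ρ t x)) (S.gradSqrtρ t)
  weakLap : ∀ ξ : ℝ → X → ℝ, Smooth ξ →
    stInt T (fun t x => S.lapρ t x * ξ t x) = stInt T (fun t x => S.ρ t x * lap (ξ t) x)
  v_eq : ∀ t ∈ Icc 0 T, ∀ᵐ x ∂torusMeasure, 0 < S.ρ t x →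
    S.v t x = (2 * ν) • ((S.ρ t x)⁻¹ • S.gradρ t x)
  tensor_u : IsTensorOf T S.ρ S.gradSqrtρ S.u S.Tu
  tensor_v : IsTensorOf T S.ρ S.gradSqrtρ S.v S.Tv
  tensor_w : IsTensorOf T S.ρ S.gradSqrtρ S.w S.Tw
  -- continuity equation
  continuity : ∀ φ : ℝ → X → ℝ, Smooth φ → ∀ τ ∈ Icc 0 T,
    - spaceInt (fun x => S.ρ τ x * φ τ x) + spaceInt (fun x => S.ρ 0 x * φ 0 x)
      + stInt τ (fun t x => S.ρ t x * dt φ t x + S.ρ t x * (S.u t x ⬝ᵥ grad (φ t) x)) = 0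
  -- equation of `ρw`
  momentum_w : ∀ φ : ℝ → X → X, Smooth φ → ∀ τ ∈ Icc 0 T,
    - spaceInt (fun x => S.ρ τ x * (S.w τ x ⬝ᵥ φ τ x))
      + spaceInt (fun x => S.ρ 0 x * (S.w 0 x ⬝ᵥ φ 0 x))
      + stInt τ (fun t x =>
          S.ρ t x * (S.w t x ⬝ᵥ dt φ t x)
          + S.ρ t x * colon (Matrix.vecMulVec (S.w t x) (S.u t x)) (jac (φ t) x)
          + pressure γ (S.ρ t x) * dvg (φ t) x
          - 2 * ν * (√(S.ρ t x) * colon (S.Tw t x) (jac (φ t) x))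
          + 2 * ν * (√(S.ρ t x) * colon (S.Tv t x) (jac (φ t) x)))
      + 2 * κ ^ 2 * stInt τ (S.capillary φ) = 0
  -- equation of `ρv`
  momentum_v : ∀ φ : ℝ → X → X, Smooth φ → ∀ τ ∈ Icc 0 T,
    - spaceInt (fun x => S.ρ τ x * (S.v τ x ⬝ᵥ φ τ x))
      + spaceInt (fun x => S.ρ 0 x * (S.v 0 x ⬝ᵥ φ 0 x))
      + stInt τ (fun t x =>
          S.ρ t x * (S.v t x ⬝ᵥ dt φ t x)
          + S.ρ t x * colon (Matrix.vecMulVec (S.v t x) (S.u t x)) (jac (φ t) x)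
          - 2 * ν * (√(S.ρ t x) * colon (S.Tv t x)ᵀ (jac (φ t) x))
          + 2 * ν * (√(S.ρ t x) * colon (S.Tw t x)ᵀ (jac (φ t) x))) = 0
  -- energy inequality, integrated in time
  energy_ineq : ∀ τ ∈ Icc 0 T,
    S.energy κ H τ + 2 * ν * stInt τ (S.viscousDissipation γ)
      + 4 * ν * κ ^ 2 * stInt τ (fun t x => S.lapρ t x ^ 2) ≤ S.energy κ H 0

end NSK

end

open NSK

/-!
The relative entropy inequality is the energy inequality plus identities: nothing else in the proof
is lossy.

Expanding the squares and the Bregman distance `H(ρ|r)`, and integrating `∇ρ · ∇r` by parts, the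
relative entropy at a fixed time is the energy plus
`-∫ρw·W - ∫ρv·V + ½∫ρ(|W|² + |V|²) + 2κ²∫ρΔr + κ²∫|∇r|² - ∫ρH'(r) + ∫(H'(r)r - H(r))`
(`IsWeakSolution.relEntropy_eq`). The change in time of each of these terms is an explicit
space-time integral:

* the terms with `W` and `V` by the momentum equations tested with `W`, `V` and the continuity
  equation tested with `½|W|²`, `½|V|²` (`stInt_relative_transport`, `stInt_transport_w`,
  `stInt_transport_v`);
* the capillary terms by the continuity equation tested with `Δr`, together with
  `½ d/dt ∫|∇r|² = -∫ ∂ₜr Δr` (`stInt_capillary_reference`);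
* the pressure terms by the continuity equation tested with `H'(r)`, together with
  `d/dt (H'(r)r - H(r)) = ∂ₜ(H'(r)) r` (`stInt_pressure_reference`). As `r` need not be positive
  outside `[0,T]`, the test function is `H'(q)` for a positive smooth `q` that agrees with `r` near
  `[0,T]` (`Smooth.exists_pos_extension`).

Splitting the space-time integrals requires all terms to be integrable on `(0,T) × 𝕋³`. The
momentum and the convective terms are products `√ρ · √ρa` and `√ρa · √ρb` of
functions that are bounded in time with values in `L²`, because `ρ ≥ 0` almost everywhere.
-/

open MeasureTheory Set
open scoped ContDiff Matrix

namespace NSK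

/-! ### Calculus of smooth functions on the torus -/

namespace Smooth

section Calculus

variable {E : Type*} [NormedAddCommGroup E] [NormedSpace ℝ E] {φ : ℝ → X → E}

lemma contDiff_slice (h : NSK.Smooth φ) (t : ℝ) : ContDiff ℝ ∞ (φ t) :=
  h.contDiff.comp (contDiff_const.prodMk contDiff_id)

lemma contDiff_time (h : NSK.Smooth φ) (x : X) : ContDiff ℝ ∞ (fun t => φ t x) :=
  h.contDiff.comp (contDiff_id.prodMk contDiff_const)

lemma continuous (h : NSK.Smooth φ) : Continuous fun z : ℝ × X => φ z.1 z.2 :=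
  h.contDiff.continuous

lemma continuous_slice (h : NSK.Smooth φ) (t : ℝ) : Continuous (φ t) :=
  (h.contDiff_slice t).continuous

lemma differentiableAt_slice (h : NSK.Smooth φ) (t : ℝ) (x : X) : DifferentiableAt ℝ (φ t) x :=
  (h.contDiff_slice t).contDiffAt.differentiableAt (by simp)

lemma differentiableAt_time (h : NSK.Smooth φ) (t : ℝ) (x : X) :
    DifferentiableAt ℝ (fun s => φ s x) t :=
  (h.contDiff_time x).contDiffAt.differentiableAt (by simp)

lemma hasFDerivAt (h : NSK.Smooth φ) (z : ℝ × X) :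
    HasFDerivAt (fun z : ℝ × X => φ z.1 z.2) (fderiv ℝ (fun z : ℝ × X => φ z.1 z.2) z) z :=
  (h.contDiff.contDiffAt.differentiableAt (by simp)).hasFDerivAt

/-- The time derivative is the directional derivative of the uncurried function along the time
axis. -/
lemma dt_eq_fderiv (h : NSK.Smooth φ) (t : ℝ) (x : X) :
    dt φ t x = fderiv ℝ (fun z : ℝ × X => φ z.1 z.2) (t, x) (1, 0) := by
  have h1 : HasDerivAt (fun s : ℝ => ((s, x) : ℝ × X)) (1, 0) t :=
    (hasDerivAt_id t).prodMk (hasDerivAt_const t x)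
  exact ((h.hasFDerivAt (t, x)).comp_hasDerivAt t h1).deriv

lemma hasDerivAt_dt (h : NSK.Smooth φ) (t : ℝ) (x : X) :
    HasDerivAt (fun s => φ s x) (dt φ t x) t :=
  (h.differentiableAt_time t x).hasDerivAt

lemma dt (h : NSK.Smooth φ) : NSK.Smooth (dt φ) where
  contDiff := by
    have h1 : (fun z : ℝ × X => NSK.dt φ z.1 z.2) =
        fun z => fderiv ℝ (fun z : ℝ × X => φ z.1 z.2) z (1, 0) := by
      funext z; exact h.dt_eq_fderiv z.1 z.2
    rw [h1]
    exact (h.contDiff.fderiv_right (by simp)).clm_apply contDiff_const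
  periodic t i x := by
    have : (fun s => φ s (x + Pi.single i 1)) = fun s => φ s x := by
      funext s; exact h.periodic s i x
    simp only [NSK.dt, this]

end Calculus

variable {φ ψ : ℝ → X → ℝ}

/-- The partial derivative is the directional derivative of the uncurried function along a
space axis. -/
lemma pd_eq_fderiv (h : NSK.Smooth φ) (i : Fin 3) (t : ℝ) (x : X) :
    pd i (φ t) x = fderiv ℝ (fun z : ℝ × X => φ z.1 z.2) (t, x) (0, Pi.single i 1) := by
  have h1 : HasFDerivAt (fun y : X => ((t, y) : ℝ × X)) (ContinuousLinearMap.inr ℝ ℝ X) x :=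
    hasFDerivAt_prodMk_right t x
  have h2 := (h.hasFDerivAt (t, x)).comp x h1
  unfold NSK.pd
  have h3 : φ t = (fun z : ℝ × X => φ z.1 z.2) ∘ fun y : X => ((t, y) : ℝ × X) := rfl
  rw [h3, h2.fderiv]
  simp

lemma pd (h : NSK.Smooth φ) (i : Fin 3) : NSK.Smooth (fun t => pd i (φ t)) where
  contDiff := by
    have h1 : (fun z : ℝ × X => NSK.pd i (φ z.1) z.2) =
        fun z => fderiv ℝ (fun z : ℝ × X => φ z.1 z.2) z (0, Pi.single i 1) := by
      funext z; exact h.pd_eq_fderiv i z.1 z.2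
    rw [h1]
    exact (h.contDiff.fderiv_right (by simp)).clm_apply contDiff_const
  periodic t j x := by
    have h1 : (fun y => φ t (y + Pi.single j 1)) = φ t := by
      funext y; exact h.periodic t j y
    have h2 := fderiv_comp_add_right (𝕜 := ℝ) (f := φ t) (x := x) (Pi.single j 1)
    rw [h1] at h2
    simp only [NSK.pd, h2]

/-- Time and space derivatives commute, by the symmetry of the second derivative. -/
lemma dt_pd (h : NSK.Smooth φ) (i : Fin 3) (t : ℝ) (x : X) :
    NSK.dt (fun s => NSK.pd i (φ s)) t x = NSK.pd i (NSK.dt φ t) x := by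
  set F : ℝ × X → ℝ := fun z => φ z.1 z.2 with hF
  have hd : DifferentiableAt ℝ (fderiv ℝ F) (t, x) :=
    (h.contDiff.fderiv_right (m := ∞) (by simp)).contDiffAt.differentiableAt (by simp)
  have key : ∀ a b : ℝ × X,
      fderiv ℝ (fun z => fderiv ℝ F z a) (t, x) b = fderiv ℝ (fderiv ℝ F) (t, x) b a := by
    intro a b
    rw [fderiv_clm_apply hd (differentiableAt_const a)]
    simp
  have sym : IsSymmSndFDerivAt ℝ F (t, x) :=
    h.contDiff.contDiffAt.isSymmSndFDerivAt (by simpa using ENat.LEInfty.out)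
  rw [(h.pd i).dt_eq_fderiv, h.dt.pd_eq_fderiv]
  have e1 : (fun z : ℝ × X => NSK.pd i (φ z.1) z.2) = fun z => fderiv ℝ F z (0, Pi.single i 1) := by
    funext z; exact h.pd_eq_fderiv i z.1 z.2
  have e2 : (fun z : ℝ × X => NSK.dt φ z.1 z.2) = fun z => fderiv ℝ F z (1, 0) := by
    funext z; exact h.dt_eq_fderiv z.1 z.2
  rw [e1, e2, key, key]
  exact sym _ _

lemma sub (h : NSK.Smooth φ) (h' : NSK.Smooth ψ) : NSK.Smooth (fun t x => φ t x - ψ t x) where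
  contDiff := h.contDiff.sub h'.contDiff
  periodic t i x := by simp only [h.periodic t i x, h'.periodic t i x]

lemma mul (h : NSK.Smooth φ) (h' : NSK.Smooth ψ) : NSK.Smooth (fun t x => φ t x * ψ t x) where
  contDiff := h.contDiff.mul h'.contDiff
  periodic t i x := by simp only [h.periodic t i x, h'.periodic t i x]

lemma const_mul (h : NSK.Smooth φ) (c : ℝ) : NSK.Smooth (fun t x => c * φ t x) where
  contDiff := contDiff_const.mul h.contDiff
  periodic t i x := by simp only [h.periodic t i x]

lemma sum {f : Fin 3 → ℝ → X → ℝ} (h : ∀ i, NSK.Smooth (f i)) :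
    NSK.Smooth (fun t x => ∑ i, f i t x) where
  contDiff := ContDiff.sum fun i _ => (h i).contDiff
  periodic t i x := Finset.sum_congr rfl fun j _ => (h j).periodic t i x

lemma lap (h : NSK.Smooth φ) : NSK.Smooth (fun t => lap (φ t)) :=
  Smooth.sum fun i => (h.pd i).pd i

/-- Composition with a function of one real variable that is smooth where it is needed. -/
lemma comp {g : ℝ → ℝ} (h : NSK.Smooth φ) (hg : ContDiffOn ℝ ∞ g (Ioi 0))
    (hpos : ∀ t x, 0 < φ t x) : NSK.Smooth (fun t x => g (φ t x)) where
  contDiff := hg.comp_contDiff h.contDiff fun z => hpos z.1 z.2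
  periodic t i x := by simp only [h.periodic t i x]

section Vector

variable {Φ Ψ : ℝ → X → X}

lemma apply (h : NSK.Smooth Φ) (i : Fin 3) : NSK.Smooth (fun t x => Φ t x i) where
  contDiff := contDiff_pi.1 h.contDiff i
  periodic t j x := by simp only [h.periodic t j x]

lemma dt_apply (h : NSK.Smooth Φ) (t : ℝ) (x : X) (i : Fin 3) :
    NSK.dt Φ t x i = NSK.dt (fun s y => Φ s y i) t x :=
  ((hasDerivAt_pi.1 (h.hasDerivAt_dt t x) i).deriv).symm

lemma dotProduct (h : NSK.Smooth Φ) (h' : NSK.Smooth Ψ) :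
    NSK.Smooth (fun t x => Φ t x ⬝ᵥ Ψ t x) :=
  Smooth.sum fun i => (h.apply i).mul (h'.apply i)

lemma jac_apply (h : NSK.Smooth Φ) (i j : Fin 3) : NSK.Smooth (fun t x => jac (Φ t) x i j) :=
  (h.apply i).pd j

lemma dvg (h : NSK.Smooth Φ) : NSK.Smooth (fun t => dvg (Φ t)) :=
  Smooth.sum fun i => (h.apply i).pd i

lemma dt_sqn (h : NSK.Smooth Φ) (t : ℝ) (x : X) :
    NSK.dt (fun s y => sqn (Φ s y)) t x = 2 * (NSK.dt Φ t x ⬝ᵥ Φ t x) := by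
  have h1 : HasDerivAt (fun s => ∑ i, Φ s x i * Φ s x i)
      (∑ i, (NSK.dt Φ t x i * Φ t x i + Φ t x i * NSK.dt Φ t x i)) t :=
    HasDerivAt.fun_sum fun i _ => (hasDerivAt_pi.1 (h.hasDerivAt_dt t x) i).mul
      (hasDerivAt_pi.1 (h.hasDerivAt_dt t x) i)
  refine h1.deriv.trans ?_
  rw [_root_.dotProduct, Finset.mul_sum]
  exact Finset.sum_congr rfl fun i _ => by ring

lemma pd_sqn (h : NSK.Smooth Φ) (t : ℝ) (x : X) (j : Fin 3) :
    NSK.pd j (fun y => sqn (Φ t y)) x = 2 * ∑ i, jac (Φ t) x i j * Φ t x i := by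
  have hd : ∀ i, HasFDerivAt (fun y => Φ t y i) (fderiv ℝ (fun y => Φ t y i) x) x := fun i =>
    ((h.apply i).differentiableAt_slice t x).hasFDerivAt
  have h1 : HasFDerivAt (fun y => ∑ i, Φ t y i * Φ t y i) _ x :=
    HasFDerivAt.fun_sum fun i _ => (hd i).mul (hd i)
  have h2 : NSK.pd j (fun y => sqn (Φ t y)) x = _ :=
    congrArg (fun L : X →L[ℝ] ℝ => L (Pi.single j 1)) h1.fderiv
  rw [h2, Finset.mul_sum]
  simp only [_root_.sum_apply, _root_.add_apply,
    _root_.smul_apply, smul_eq_mul, jac, Matrix.of_apply, NSK.pd]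
  exact Finset.sum_congr rfl fun i _ => by ring

end Vector

lemma grad (h : NSK.Smooth φ) : NSK.Smooth (fun t => grad (φ t)) where
  contDiff := contDiff_pi.2 fun i => (h.pd i).contDiff
  periodic t i x := by
    funext j; exact (h.pd j).periodic t i x

end Smooth

/-! ### Integrals of smooth functions over the torus -/

instance : IsFiniteMeasure torusMeasure := by
  refine ⟨?_⟩
  rw [torusMeasure, Measure.restrict_apply_univ]
  exact isCompact_Icc.measure_lt_top

instance (T : ℝ) : IsFiniteMeasure (slab T) := by
  unfold slab; infer_instance

lemma _root_.Continuous.integrable_torus {f : X → ℝ} (hf : Continuous f) :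
    Integrable f torusMeasure :=
  hf.continuousOn.integrableOn_compact isCompact_Icc

/-- The integral of a partial derivative of a smooth function on the torus vanishes: the fluxes
through opposite faces of the unit cube cancel. -/
lemma spaceInt_pd_eq_zero {f : X → ℝ} (hf : ContDiff ℝ ∞ f) (hp : Periodic f) (i : Fin 3) :
    spaceInt (pd i f) = 0 := by
  have hd : ∀ x, HasFDerivAt f (fderiv ℝ f x) x := fun x =>
    (hf.contDiffAt.differentiableAt (by simp)).hasFDerivAt
  have hc : Continuous (pd i f) :=
    ((hf.fderiv_right (m := ∞) (by simp)).clm_apply contDiff_const).continuous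
  have hsum : ∀ x, ∑ j, (if j = i then fderiv ℝ f x else 0) (Pi.single j 1) = pd i f x := by
    intro x
    rw [Finset.sum_eq_single i (fun j _ hj => by simp [hj]) (by simp)]
    simp [pd]
  have key := integral_divergence_of_hasFDerivAt_off_countable' (n := 2) (E := ℝ) (a := 0) (b := 1)
    (fun _ => zero_le_one) (fun j => if j = i then f else 0)
    (fun j => if j = i then fderiv ℝ f else 0) ∅ countable_empty
    (fun j => by
      by_cases hj : j = i
      · simpa [hj] using hf.continuous.continuousOn
      · rw [if_neg hj]; exact continuousOn_const)
    (fun x _ j => by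
      by_cases hj : j = i
      · simpa [hj] using hd x
      · simp only [if_neg hj]; exact hasFDerivAt_const (0 : ℝ) x)
    (by
      have : (fun x => ∑ j, (if j = i then fderiv ℝ f else 0) x (Pi.single j 1)) = pd i f := by
        funext x
        rw [← hsum x]
        exact Finset.sum_congr rfl fun j _ => by split_ifs <;> rfl
      rw [this]
      exact hc.integrable_torus)
  -- Periodicity identifies opposite faces.
  have hface : ∀ y : Fin 2 → ℝ, f (i.insertNth 1 y) = f (i.insertNth 0 y) := by
    intro y
    rw [← hp i (i.insertNth 0 y)]
    congr 1
    funext k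
    refine Fin.succAboveCases i ?_ (fun j => ?_) k
    · simp
    · simp
  calc spaceInt (pd i f) = ∫ x in Icc (0 : X) 1, ∑ j,
        (if j = i then fderiv ℝ f else 0) x (Pi.single j 1) := by
        refine integral_congr_ae (.of_forall fun x => ?_)
        simp only
        rw [← hsum x]
        exact Finset.sum_congr rfl fun j _ => by split_ifs <;> rfl
    _ = _ := key
    _ = 0 := by
        refine Finset.sum_eq_zero fun j _ => ?_
        by_cases hj : j = i
        · subst hj; simp [hface]
        · simp [hj]

lemma spaceInt_mul_pd {φ ψ : ℝ → X → ℝ} (h : NSK.Smooth φ) (h' : NSK.Smooth ψ) (i : Fin 3) (t : ℝ) :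
    spaceInt (fun x => φ t x * pd i (ψ t) x) = - spaceInt (fun x => pd i (φ t) x * ψ t x) := by
  have h0 := spaceInt_pd_eq_zero ((h.mul h').contDiff_slice t) ((h.mul h').periodic t) i
  have e : pd i (fun x => φ t x * ψ t x) =
      fun x => φ t x * pd i (ψ t) x + pd i (φ t) x * ψ t x := by
    funext x
    have := ((h.differentiableAt_slice t x).hasFDerivAt.mul
      (h'.differentiableAt_slice t x).hasFDerivAt).fderiv
    refine (congrArg (fun L : X →L[ℝ] ℝ => L (Pi.single i 1)) this).trans ?_
    simp only [_root_.add_apply, _root_.smul_apply, smul_eq_mul, pd]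
    ring
  rw [e, spaceInt, integral_add] at h0
  · exact eq_neg_of_add_eq_zero_left h0
  · exact (((h.mul (h'.pd i)).continuous_slice t)).integrable_torus
  · exact ((((h.pd i).mul h').continuous_slice t)).integrable_torus

/-- Green's formula on the torus. -/
lemma spaceInt_mul_lap {φ ψ : ℝ → X → ℝ} (h : NSK.Smooth φ) (h' : NSK.Smooth ψ) (t : ℝ) :
    spaceInt (fun x => φ t x * lap (ψ t) x) =
      - spaceInt (fun x => grad (φ t) x ⬝ᵥ grad (ψ t) x) := by
  have h1 : ∀ i, spaceInt (fun x => φ t x * pd i (pd i (ψ t)) x) =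
      - spaceInt (fun x => pd i (φ t) x * pd i (ψ t) x) := fun i =>
    spaceInt_mul_pd h (h'.pd i) i t
  simp only [lap, Finset.mul_sum, dotProduct, grad, spaceInt] at h1 ⊢
  rw [integral_finsetSum, integral_finsetSum, ← Finset.sum_neg_distrib]
  · exact Finset.sum_congr rfl fun i _ => h1 i
  · exact fun i _ => (((h.pd i).mul (h'.pd i)).continuous_slice t).integrable_torus
  · exact fun i _ => ((h.mul ((h'.pd i).pd i)).continuous_slice t).integrable_torus

/-- The fundamental theorem of calculus for space integrals of smooth functions. -/
lemma stInt_dt {φ : ℝ → X → ℝ} (h : NSK.Smooth φ) {τ : ℝ} :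
    stInt τ (dt φ) = spaceInt (φ τ) - spaceInt (φ 0) := by
  have hint : Integrable (Function.uncurry (dt φ))
      ((volume.restrict (uIoc 0 τ)).prod torusMeasure) := by
    rw [torusMeasure, Measure.prod_restrict]
    have : IntegrableOn (Function.uncurry (dt φ)) (uIcc 0 τ ×ˢ cube)
        ((volume : Measure ℝ).prod (volume : Measure X)) :=
      h.dt.continuous.continuousOn.integrableOn_compact (isCompact_uIcc.prod isCompact_Icc)
    exact this.mono_set (prod_mono uIoc_subset_uIcc subset_rfl)
  unfold stInt spaceInt
  rw [← integral_sub (h.continuous_slice τ).integrable_torus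
      (h.continuous_slice 0).integrable_torus,
    intervalIntegral_integral_swap hint]
  refine integral_congr_ae (.of_forall fun x => ?_)
  refine intervalIntegral.integral_eq_sub_of_hasDerivAt (fun t _ => h.hasDerivAt_dt t x) ?_
  exact (h.dt.contDiff_time x).continuous.intervalIntegrable _ _

/-! ### Space-time integrals -/

lemma slab_eq (T : ℝ) : slab T = volume.restrict (Ioc 0 T ×ˢ cube) := by
  rw [slab, torusMeasure, Measure.prod_restrict]; rfl

lemma ae_slab_mem (T : ℝ) : ∀ᵐ z ∂slab T, z ∈ Ioc 0 T ×ˢ cube := by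
  rw [slab_eq]
  exact ae_restrict_mem (measurableSet_Ioc.prod measurableSet_Icc)

/-- A pointwise-in-time almost everywhere bound from below holds almost everywhere in space-time. -/
lemma ae_slab_nonneg {T : ℝ} {F : ℝ → X → ℝ} (hm : MeasOn T F)
    (h : ∀ t ∈ Icc 0 T, ∀ᵐ x ∂torusMeasure, 0 ≤ F t x) : ∀ᵐ z ∂slab T, 0 ≤ F z.1 z.2 := by
  obtain ⟨G, hG, hFG⟩ := hm
  have h1 : ∀ᵐ t ∂(volume.restrict (Ioc 0 T)), ∀ᵐ x ∂torusMeasure, F t x = G (t, x) :=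
    Measure.ae_ae_of_ae_prod hFG
  have h2 : ∀ᵐ z ∂slab T, 0 ≤ G z := by
    refine (Measure.ae_prod_iff_ae_ae (measurableSet_le measurable_const hG.measurable)).2 ?_
    filter_upwards [h1, ae_restrict_mem measurableSet_Ioc] with t ht htT
    filter_upwards [ht, h t (Ioc_subset_Icc_self htT)] with x hx hx'
    rwa [← hx]
  filter_upwards [h2, hFG] with z hz hz'
  rw [hz']; exact hz

/-- Functions that are bounded in time with values in `L²(𝕋³)` are square integrable in
space-time. -/
lemma LinfL2.memLp_slab {T : ℝ} {F : ℝ → X → ℝ} (h : LinfL2 T F) (hm : MeasOn T F) :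
    MemLp (fun z : ℝ × X => F z.1 z.2) 2 (slab T) := by
  obtain ⟨C, hC⟩ := h
  rw [memLp_two_iff_integrable_sq hm]
  have hm2 : AEStronglyMeasurable (fun z : ℝ × X => F z.1 z.2 ^ 2) (slab T) := hm.pow 2
  refine (integrable_prod_iff hm2).2 ⟨?_, ?_⟩
  · filter_upwards [ae_restrict_mem measurableSet_Ioc] with t ht
    exact (hC t (Ioc_subset_Icc_self ht)).1.integrable_sq
  · refine Integrable.of_bound hm2.norm.integral_prod_right' C ?_
    filter_upwards [ae_restrict_mem measurableSet_Ioc] with t ht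
    have h1 : ∀ x, ‖F t x ^ 2‖ = F t x ^ 2 := fun x => Real.norm_of_nonneg (sq_nonneg _)
    simp only [h1]
    rw [Real.norm_of_nonneg (integral_nonneg fun x => sq_nonneg _)]
    exact (hC t (Ioc_subset_Icc_self ht)).2

namespace IntegrableSlab

variable {T : ℝ} {F G : ℝ → X → ℝ}

lemma add (hF : IntegrableSlab T F) (hG : IntegrableSlab T G) :
    IntegrableSlab T (fun t x => F t x + G t x) := Integrable.add hF hG

lemma sub (hF : IntegrableSlab T F) (hG : IntegrableSlab T G) :
    IntegrableSlab T (fun t x => F t x - G t x) := Integrable.sub hF hG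

lemma const_mul (hF : IntegrableSlab T F) (c : ℝ) :
    IntegrableSlab T (fun t x => c * F t x) := Integrable.const_mul hF c

lemma sum {f : Fin 3 → ℝ → X → ℝ} (h : ∀ i, IntegrableSlab T (f i)) :
    IntegrableSlab T (fun t x => ∑ i, f i t x) :=
  integrable_finsetSum _ fun i _ => h i

lemma mul_smooth (hF : IntegrableSlab T F) {φ : ℝ → X → ℝ} (hφ : NSK.Smooth φ) :
    IntegrableSlab T (fun t x => F t x * φ t x) := by
  obtain ⟨C, hC⟩ := ((isCompact_Icc (a := (0 : ℝ)) (b := T)).prod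
    (isCompact_Icc (a := (0 : X)) (b := 1))).exists_bound_of_continuousOn
    hφ.continuous.continuousOn
  refine Integrable.mul_bdd (c := C) hF hφ.continuous.aestronglyMeasurable ?_
  filter_upwards [ae_slab_mem T] with z hz
  exact hC z ⟨Ioc_subset_Icc_self hz.1, hz.2⟩

lemma mul_dotProduct {a Φ : ℝ → X → X} (h : ∀ i, IntegrableSlab T (fun t x => F t x * a t x i))
    (hΦ : NSK.Smooth Φ) : IntegrableSlab T (fun t x => F t x * (a t x ⬝ᵥ Φ t x)) := by
  have := IntegrableSlab.sum fun i => (h i).mul_smooth (hΦ.apply i)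
  simpa only [dotProduct, Finset.mul_sum, mul_assoc] using this

lemma mul_colon_jac {A : ℝ → X → Mat} {Φ : ℝ → X → X}
    (h : ∀ i j, IntegrableSlab T (fun t x => F t x * A t x i j))
    (hΦ : NSK.Smooth Φ) : IntegrableSlab T (fun t x => F t x * colon (A t x) (jac (Φ t) x)) := by
  have := IntegrableSlab.sum fun i => IntegrableSlab.sum fun j =>
    (h i j).mul_smooth (hΦ.jac_apply i j)
  simpa only [colon, Finset.mul_sum, mul_assoc] using this

end IntegrableSlab

lemma Smooth.integrableSlab {φ : ℝ → X → ℝ} (hφ : NSK.Smooth φ) (T : ℝ) : IntegrableSlab T φ := by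
  have h1 : IntegrableSlab T (fun _ _ => 1) := integrable_const _
  simpa using h1.mul_smooth hφ

section Linearity

variable {T τ : ℝ} {F G : ℝ → X → ℝ}

lemma stInt_eq_integral_slab (hτ : τ ∈ Icc 0 T) (hF : IntegrableSlab T F) :
    Integrable (fun z : ℝ × X => F z.1 z.2) (slab τ) ∧
      stInt τ F = ∫ z, F z.1 z.2 ∂slab τ := by
  have hi : Integrable (fun z : ℝ × X => F z.1 z.2) (slab τ) := by
    unfold IntegrableSlab at hF
    rw [slab_eq] at hF ⊢
    exact hF.mono_measure (Measure.restrict_mono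
      (prod_mono (Ioc_subset_Ioc_right hτ.2) subset_rfl) le_rfl)
  refine ⟨hi, ?_⟩
  rw [stInt, intervalIntegral.integral_of_le hτ.1]
  exact (integral_prod _ hi).symm

lemma stInt_add (hτ : τ ∈ Icc 0 T) (hF : IntegrableSlab T F) (hG : IntegrableSlab T G) :
    stInt τ (fun t x => F t x + G t x) = stInt τ F + stInt τ G := by
  rw [(stInt_eq_integral_slab hτ hF).2, (stInt_eq_integral_slab hτ hG).2,
    (stInt_eq_integral_slab hτ (hF.add hG)).2]
  exact integral_add (stInt_eq_integral_slab hτ hF).1 (stInt_eq_integral_slab hτ hG).1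

lemma stInt_sub (hτ : τ ∈ Icc 0 T) (hF : IntegrableSlab T F) (hG : IntegrableSlab T G) :
    stInt τ (fun t x => F t x - G t x) = stInt τ F - stInt τ G := by
  rw [(stInt_eq_integral_slab hτ hF).2, (stInt_eq_integral_slab hτ hG).2,
    (stInt_eq_integral_slab hτ (hF.sub hG)).2]
  exact integral_sub (stInt_eq_integral_slab hτ hF).1 (stInt_eq_integral_slab hτ hG).1

lemma stInt_const_mul (c : ℝ) : stInt τ (fun t x => c * F t x) = c * stInt τ F := by
  simp only [stInt, spaceInt, integral_const_mul, intervalIntegral.integral_const_mul]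

lemma stInt_congr (hτ : τ ∈ Icc 0 T) (h : ∀ t ∈ Icc 0 T, ∀ x, F t x = G t x) :
    stInt τ F = stInt τ G := by
  refine intervalIntegral.integral_congr fun t ht => ?_
  rw [uIcc_of_le hτ.1] at ht
  have : F t = G t := funext fun x => h t ⟨ht.1, ht.2.trans hτ.2⟩ x
  simp only [this]

end Linearity

section SpaceIntegrals

variable {f g : X → ℝ}

lemma spaceInt_add (hf : Integrable f torusMeasure) (hg : Integrable g torusMeasure) :
    spaceInt (fun x => f x + g x) = spaceInt f + spaceInt g := integral_add hf hg

lemma spaceInt_sub (hf : Integrable f torusMeasure) (hg : Integrable g torusMeasure) :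
    spaceInt (fun x => f x - g x) = spaceInt f - spaceInt g := integral_sub hf hg

lemma spaceInt_const_mul (c : ℝ) : spaceInt (fun x => c * f x) = c * spaceInt f :=
  integral_const_mul c f

lemma spaceInt_congr (h : ∀ x, f x = g x) : spaceInt f = spaceInt g := by
  rw [funext h]

end SpaceIntegrals

/-- Half the change of `∫|∇r|²` is `-∫∫ ∂ₜr Δr`. -/
lemma stInt_dt_mul_lap {τ : ℝ} {r : ℝ → X → ℝ} (hr : NSK.Smooth r) :
    2 * stInt τ (fun t x => dt r t x * lap (r t) x) =
      spaceInt (fun x => sqn (grad (r 0) x)) - spaceInt (fun x => sqn (grad (r τ) x)) := by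
  have h1 := stInt_dt (φ := fun t x => sqn (grad (r t) x)) (hr.grad.dotProduct hr.grad) (τ := τ)
  have h2 : stInt τ (dt fun t x => sqn (grad (r t) x)) =
      stInt τ (fun t x => (-2) * (dt r t x * lap (r t) x)) := by
    unfold stInt
    congr 1
    funext t
    have h3 := spaceInt_mul_lap hr.dt hr t
    have h4 : ∀ x, dt (fun s => grad (r s)) t x = grad (dt r t) x := fun x => by
      funext i
      rw [hr.grad.dt_apply]
      exact hr.dt_pd i t x
    simp only [hr.grad.dt_sqn, h4, spaceInt, integral_const_mul] at h3 ⊢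
    rw [h3]
    ring
  rw [stInt_const_mul] at h2
  linarith

/-! ### The pressure potential -/

namespace IsPressurePotential

variable {γ : ℝ} {H : ℝ → ℝ}

/-- Integrating `H'' (s) = γ s^(γ-2)` twice. -/
lemma exists_explicit (hγ : 1 < γ) (hH : IsPressurePotential γ H) :
    ∃ c d : ℝ, (∀ s, 0 < s → deriv H s = γ / (γ - 1) * s ^ (γ - 1) + c) ∧
      ∀ s, 0 ≤ s → H s = 1 / (γ - 1) * s ^ γ + c * s + d := by
  have hγ1 : γ - 1 ≠ 0 := by linarith
  have h1 : ∀ s ∈ Ioi (0 : ℝ), HasDerivAt (fun s => deriv H s - γ / (γ - 1) * s ^ (γ - 1)) 0 s := by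
    intro s (hs : 0 < s)
    have hp : deriv (pressure γ) s = γ * s ^ (γ - 1) :=
      (Real.hasDerivAt_rpow_const (Or.inl hs.ne')).deriv
    refine ((hH.second_deriv s hs).sub
      ((Real.hasDerivAt_rpow_const (p := γ - 1) (Or.inl hs.ne')).const_mul
        (γ / (γ - 1)))).congr_deriv ?_
    rw [hp, Real.rpow_sub_one hs.ne' (γ - 1)]
    field_simp
    ring
  obtain ⟨c, hc⟩ := isOpen_Ioi.exists_is_const_of_deriv_eq_zero isPreconnected_Ioi
    (fun s hs => (h1 s hs).differentiableAt.differentiableWithinAt) (fun s hs => (h1 s hs).deriv)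
  have hH' : ∀ s, 0 < s → deriv H s = γ / (γ - 1) * s ^ (γ - 1) + c := fun s hs => by
    linarith [hc s hs]
  have h2 : ∀ s ∈ Ioi (0 : ℝ), HasDerivAt (fun s => H s - (1 / (γ - 1) * s ^ γ + c * s)) 0 s := by
    intro s (hs : 0 < s)
    refine ((hH.differentiableAt s hs).hasDerivAt.sub
      (((Real.hasDerivAt_rpow_const (p := γ) (Or.inl hs.ne')).const_mul (1 / (γ - 1))).add
        ((hasDerivAt_id s).const_mul c))).congr_deriv ?_
    rw [hH' s hs]
    ring
  obtain ⟨d, hd⟩ := isOpen_Ioi.exists_is_const_of_deriv_eq_zero isPreconnected_Ioi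
    (fun s hs => (h2 s hs).differentiableAt.differentiableWithinAt) (fun s hs => (h2 s hs).deriv)
  refine ⟨c, d, hH', fun s hs => ?_⟩
  have heq : EqOn H (fun s => 1 / (γ - 1) * s ^ γ + c * s + d) (Ioi 0) := fun s hs => by
    simp only
    linarith [hd s hs]
  have hcont : ContinuousOn (fun s : ℝ => 1 / (γ - 1) * s ^ γ + c * s + d) (Ici 0) := by
    refine Continuous.continuousOn ?_
    have := Real.continuous_rpow_const (q := γ) (by linarith)
    fun_prop
  exact heq.of_subset_closure hH.continuousOn hcont Ioi_subset_Ici_self (by simp) hs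

lemma contDiffOn_deriv (hγ : 1 < γ) (hH : IsPressurePotential γ H) :
    ContDiffOn ℝ ∞ (deriv H) (Ioi 0) := by
  obtain ⟨c, d, h1, -⟩ := hH.exists_explicit hγ
  refine ContDiffOn.congr (f := fun s => γ / (γ - 1) * s ^ (γ - 1) + c) ?_ h1
  intro s hs
  exact ((contDiffAt_const.mul
    (Real.contDiffAt_rpow_const_of_ne (ne_of_gt hs))).add contDiffAt_const).contDiffWithinAt

lemma contDiffOn (hγ : 1 < γ) (hH : IsPressurePotential γ H) :
    ContDiffOn ℝ ∞ H (Ioi 0) :=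
  (contDiffOn_infty_iff_deriv_of_isOpen isOpen_Ioi).2
    ⟨fun s hs => (hH.differentiableAt s hs).differentiableWithinAt, hH.contDiffOn_deriv hγ⟩

end IsPressurePotential

lemma rpow_half_sq {s : ℝ} (hs : 0 ≤ s) (γ : ℝ) : (s ^ (γ / 2)) ^ 2 = s ^ γ := by
  rw [← Real.rpow_mul_natCast hs]
  congr 1
  push_cast
  ring

/-! ### Integrability of the terms of the weak formulation -/

namespace IsWeakSolution

variable {ν κ γ T : ℝ} {H : ℝ → ℝ} {S : Fields}

lemma ae_nonneg (hS : IsWeakSolution ν κ γ H T S) : ∀ᵐ z ∂slab T, 0 ≤ S.ρ z.1 z.2 :=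
  ae_slab_nonneg hS.meas_ρ hS.nonneg

lemma memLp_sqrt_v (hS : IsWeakSolution ν κ γ H T S) (i : Fin 3) :
    MemLp (fun z : ℝ × X => √(S.ρ z.1 z.2) * S.v z.1 z.2 i) 2 (slab T) :=
  (hS.bound_v i).memLp_slab
    ((Real.continuous_sqrt.comp_aestronglyMeasurable hS.meas_ρ).mul (hS.meas_v i))

lemma memLp_sqrt_w (hS : IsWeakSolution ν κ γ H T S) (i : Fin 3) :
    MemLp (fun z : ℝ × X => √(S.ρ z.1 z.2) * S.w z.1 z.2 i) 2 (slab T) :=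
  (hS.bound_w i).memLp_slab
    ((Real.continuous_sqrt.comp_aestronglyMeasurable hS.meas_ρ).mul (hS.meas_w i))

lemma memLp_sqrt_u (hS : IsWeakSolution ν κ γ H T S) (i : Fin 3) :
    MemLp (fun z : ℝ × X => √(S.ρ z.1 z.2) * S.u z.1 z.2 i) 2 (slab T) := by
  have := (hS.memLp_sqrt_w i).sub (hS.memLp_sqrt_v i)
  refine this.ae_eq (.of_forall fun z => ?_)
  simp only [Pi.sub_apply, Fields.u]
  ring

lemma integrable_ρ (hS : IsWeakSolution ν κ γ H T S) : IntegrableSlab T S.ρ :=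
  (hS.bound_ρ.memLp_slab hS.meas_ρ).integrable (by norm_num)

lemma memLp_sqrt_ρ (hS : IsWeakSolution ν κ γ H T S) :
    MemLp (fun z : ℝ × X => √(S.ρ z.1 z.2)) 2 (slab T) := by
  rw [memLp_two_iff_integrable_sq (Real.continuous_sqrt.comp_aestronglyMeasurable hS.meas_ρ)]
  refine Integrable.congr hS.integrable_ρ ?_
  filter_upwards [hS.ae_nonneg] with z hz
  exact (Real.sq_sqrt hz).symm

/-- A momentum `ρ a` is the product of the square integrable functions `√ρ` and `√ρ a`. -/
lemma integrable_ρ_mul (hS : IsWeakSolution ν κ γ H T S) {f : ℝ → X → ℝ}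
    (hf : MemLp (fun z : ℝ × X => √(S.ρ z.1 z.2) * f z.1 z.2) 2 (slab T)) :
    IntegrableSlab T (fun t x => S.ρ t x * f t x) := by
  refine (hS.memLp_sqrt_ρ.integrable_mul hf).congr ?_
  filter_upwards [hS.ae_nonneg] with z hz
  simp only [Pi.mul_apply, ← mul_assoc, Real.mul_self_sqrt hz]

lemma integrable_ρ_mul_mul (hS : IsWeakSolution ν κ γ H T S) {f g : ℝ → X → ℝ}
    (hf : MemLp (fun z : ℝ × X => √(S.ρ z.1 z.2) * f z.1 z.2) 2 (slab T))
    (hg : MemLp (fun z : ℝ × X => √(S.ρ z.1 z.2) * g z.1 z.2) 2 (slab T)) :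
    IntegrableSlab T (fun t x => S.ρ t x * (f t x * g t x)) := by
  refine (hf.integrable_mul hg).congr ?_
  filter_upwards [hS.ae_nonneg] with z hz
  simp only [Pi.mul_apply]
  rw [mul_mul_mul_comm, Real.mul_self_sqrt hz]

lemma integrable_pressure_slab (hS : IsWeakSolution ν κ γ H T S) :
    IntegrableSlab T (fun t x => pressure γ (S.ρ t x)) := by
  have hm : MeasOn T (fun t x => S.ρ t x ^ (γ / 2)) :=
    (hS.meas_ρ.aemeasurable.pow_const (γ / 2)).aestronglyMeasurable
  refine (hS.bound_pressure.memLp_slab hm).integrable_sq.congr ?_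
  filter_upwards [hS.ae_nonneg] with z hz
  exact rpow_half_sq hz γ

lemma integrable_continuity (hS : IsWeakSolution ν κ γ H T S) {φ : ℝ → X → ℝ}
    (hφ : NSK.Smooth φ) : IntegrableSlab T
      (fun t x => S.ρ t x * dt φ t x + S.ρ t x * (S.u t x ⬝ᵥ grad (φ t) x)) :=
  (hS.integrable_ρ.mul_smooth hφ.dt).add
    (IntegrableSlab.mul_dotProduct (fun i => hS.integrable_ρ_mul (hS.memLp_sqrt_u i)) hφ.grad)

/-- The transport terms `ρ a · ∂ₜΦ + ρ a ⊗ u : ∇Φ` of a momentum equation are integrable. -/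
lemma integrable_transport (hS : IsWeakSolution ν κ γ H T S) {a Φ : ℝ → X → X}
    (ha : ∀ i, MemLp (fun z : ℝ × X => √(S.ρ z.1 z.2) * a z.1 z.2 i) 2 (slab T))
    (hΦ : NSK.Smooth Φ) : IntegrableSlab T
      (fun t x => S.ρ t x * (a t x ⬝ᵥ dt Φ t x)
        + S.ρ t x * colon (Matrix.vecMulVec (a t x) (S.u t x)) (jac (Φ t) x)) :=
  (IntegrableSlab.mul_dotProduct (fun i => hS.integrable_ρ_mul (ha i)) hΦ.dt).add
    (IntegrableSlab.mul_colon_jac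
      (fun i j => hS.integrable_ρ_mul_mul (ha i) (hS.memLp_sqrt_u j)) hΦ)

section Slice

variable {t : ℝ}

lemma integrable_slice_ρ (hS : IsWeakSolution ν κ γ H T S) (ht : t ∈ Icc 0 T) :
    Integrable (S.ρ t) torusMeasure := (hS.weakGrad t ht).integrable

lemma integrable_slice_ρ_smooth (hS : IsWeakSolution ν κ γ H T S) (ht : t ∈ Icc 0 T)
    {f : X → ℝ} (hf : Continuous f) : Integrable (fun x => S.ρ t x * f x) torusMeasure := by
  obtain ⟨C, hC⟩ := (isCompact_Icc (a := (0 : X)) (b := 1)).exists_bound_of_continuousOn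
    hf.continuousOn
  exact (hS.integrable_slice_ρ ht).mul_bdd (c := C) hf.aestronglyMeasurable
    ((ae_restrict_mem measurableSet_Icc).mono hC)

/-- Kinetic energies and momenta are integrable at every time. -/
lemma integrable_slice_kinetic (hS : IsWeakSolution ν κ γ H T S) (ht : t ∈ Icc 0 T)
    {a A : X → X} (ha : ∀ i, MemLp (fun x => √(S.ρ t x) * a x i) 2 torusMeasure)
    (hA : Continuous A) :
    Integrable (fun x => S.ρ t x * sqn (a x)) torusMeasure ∧
      Integrable (fun x => S.ρ t x * (a x ⬝ᵥ A x)) torusMeasure := by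
  have hsq : ∀ᵐ x ∂torusMeasure, √(S.ρ t x) * √(S.ρ t x) = S.ρ t x :=
    (hS.nonneg t ht).mono fun x hx => Real.mul_self_sqrt hx
  -- `√ρ A` is square integrable as `ρ` is integrable. Only `√ρ a` is controlled, not `a` itself,
  -- which need not even be measurable on the vacuum set at a fixed time.
  have hsA : ∀ i, MemLp (fun x => √(S.ρ t x) * A x i) 2 torusMeasure := by
    intro i
    have hAi : Continuous fun x => A x i := (continuous_apply i).comp hA
    have hm : AEStronglyMeasurable (fun x => √(S.ρ t x) * A x i) torusMeasure :=
      (Real.continuous_sqrt.comp_aestronglyMeasurable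
        (hS.integrable_slice_ρ ht).aestronglyMeasurable).mul hAi.aestronglyMeasurable
    rw [memLp_two_iff_integrable_sq hm]
    refine (hS.integrable_slice_ρ_smooth ht (hAi.pow 2)).congr ?_
    filter_upwards [hsq] with x hx
    rw [mul_pow, pow_two √_, hx, Pi.pow_apply]
  have gen : ∀ b : X → X, (∀ i, MemLp (fun x => √(S.ρ t x) * b x i) 2 torusMeasure) →
      Integrable (fun x => S.ρ t x * (a x ⬝ᵥ b x)) torusMeasure := by
    intro b hb
    have h1 : Integrable (fun x => ∑ i, (√(S.ρ t x) * a x i) * (√(S.ρ t x) * b x i))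
        torusMeasure := integrable_finsetSum _ fun i _ => (ha i).integrable_mul (hb i)
    refine h1.congr ?_
    filter_upwards [hsq] with x hx
    simp only [dotProduct, Finset.mul_sum]
    refine Finset.sum_congr rfl fun i _ => ?_
    rw [mul_mul_mul_comm, hx]
  exact ⟨gen a ha, gen A hsA⟩

lemma memLp_slice_gradρ (hS : IsWeakSolution ν κ γ H T S) (ht : t ∈ Icc 0 T) (i : Fin 3) :
    MemLp (fun x => S.gradρ t x i) 2 torusMeasure := by
  obtain ⟨C, hC⟩ := hS.bound_gradρ i
  exact (hC t ht).1

lemma integrable_slice_sqn_gradρ (hS : IsWeakSolution ν κ γ H T S) (ht : t ∈ Icc 0 T) :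
    Integrable (fun x => sqn (S.gradρ t x)) torusMeasure :=
  integrable_finsetSum Finset.univ (f := fun i x => S.gradρ t x i * S.gradρ t x i) fun i _ =>
    (hS.memLp_slice_gradρ ht i).integrable_mul (hS.memLp_slice_gradρ ht i)

lemma integrable_slice_potential (hγ : 1 < γ) (hH : IsPressurePotential γ H)
    (hS : IsWeakSolution ν κ γ H T S) (ht : t ∈ Icc 0 T) :
    Integrable (fun x => H (S.ρ t x)) torusMeasure := by
  obtain ⟨c, d, -, h⟩ := hH.exists_explicit hγ
  obtain ⟨C, hC⟩ := hS.bound_pressure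
  have h1 : Integrable (fun x => 1 / (γ - 1) * (S.ρ t x ^ (γ / 2)) ^ 2 + c * S.ρ t x + d)
      torusMeasure :=
    (((hC t ht).1.integrable_sq.const_mul _).add ((hS.integrable_slice_ρ ht).const_mul _)).add
      (integrable_const _)
  refine h1.congr ?_
  filter_upwards [hS.nonneg t ht] with x hx
  rw [h _ hx, rpow_half_sq hx]

end Slice

end IsWeakSolution

/-! ### Positive extension of the reference density -/

lemma Periodic.exists_mem_cube {E : Type*} {f : X → E} (hf : Periodic f) (x : X) :
    ∃ y ∈ Icc (0 : X) 1, f y = f x := by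
  have hp : ∀ (i : Fin 3) (n : ℤ) (y : X), f (y + n • Pi.single i 1) = f y := fun i n =>
    Function.Periodic.zsmul (f := f) (c := Pi.single i (1 : ℝ)) (hf i) n
  refine ⟨fun i => Int.fract (x i),
    ⟨fun i => Int.fract_nonneg _, fun i => (Int.fract_lt_one _).le⟩, ?_⟩
  rw [← hp 0 ⌊x 0⌋, ← hp 1 ⌊x 1⌋, ← hp 2 ⌊x 2⌋]
  congr 1
  funext i
  fin_cases i <;> simp [Int.fract_add_floor]

/-- A function that is smooth on the torus and positive on `[0,T]` agrees near `[0,T]` with a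
smooth function that is positive at all times. It is used to turn `H'(r)` into an admissible test
function. -/
lemma Smooth.exists_pos_extension {T : ℝ} {r : ℝ → X → ℝ} (hr : NSK.Smooth r)
    (hpos : ∀ t ∈ Icc 0 T, ∀ x, 0 < r t x) :
    ∃ q : ℝ → X → ℝ, NSK.Smooth q ∧ (∀ t x, 0 < q t x) ∧
      ∀ t ∈ Icc 0 T, ∀ x, (fun z : ℝ × X => q z.1 z.2) =ᶠ[nhds (t, x)] fun z => r z.1 z.2 := by
  -- A positive lower bound for `r`, found on the compact fundamental domain.
  obtain ⟨m, hm, hmr⟩ : ∃ m, 0 < m ∧ ∀ t ∈ Icc 0 T, ∀ x, 2 * m < r t x := by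
    obtain ⟨m, hm, h⟩ := ((isCompact_Icc (a := (0 : ℝ)) (b := T)).prod
      (isCompact_Icc (a := (0 : X)) (b := 1))).exists_forall_le' hr.continuous.continuousOn
      (a := 0) fun z hz => hpos z.1 hz.1 z.2
    -- `m / 3` makes the inequality strict, so that it persists near each point.
    refine ⟨m / 3, by linarith, fun t ht x => ?_⟩
    obtain ⟨y, hy, hyx⟩ := (hr.periodic t).exists_mem_cube x
    have := h (t, y) ⟨ht, hy⟩
    simp only [hyx] at this
    linarith
  -- `θ(s) = m + χ(s) (s - m)` with a cutoff `χ` that vanishes for `s ≤ m` and is `1` for `s ≥ 2m`: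
  -- a smooth function with values in `[m, ∞)` and `θ(s) = s` for `s ≥ 2m`.
  have hχ : ContDiff ℝ ∞ fun s : ℝ => Real.smoothTransition ((s - m) / m) :=
    Real.smoothTransition.contDiff.comp ((contDiff_id.sub contDiff_const).div_const m)
  have hθ : ContDiff ℝ ∞ fun s : ℝ => m + Real.smoothTransition ((s - m) / m) * (s - m) :=
    contDiff_const.add (hχ.mul (contDiff_id.sub contDiff_const))
  refine ⟨fun t x => m + Real.smoothTransition ((r t x - m) / m) * (r t x - m),
    ⟨hθ.comp hr.contDiff, fun t i x => by simp only [hr.periodic t i x]⟩, fun t x => ?_,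
    fun t ht x => ?_⟩
  · rcases le_total (r t x) m with h | h
    · simp only [Real.smoothTransition.zero_of_nonpos
        (div_nonpos_of_nonpos_of_nonneg (sub_nonpos.2 h) hm.le), zero_mul, add_zero, hm]
    · have := mul_nonneg (Real.smoothTransition.nonneg ((r t x - m) / m)) (sub_nonneg.2 h)
      linarith
  · filter_upwards [hr.continuous.continuousAt.eventually (lt_mem_nhds (hmr t ht x))] with z hz
    have : 1 ≤ (r z.1 z.2 - m) / m := by
      rw [le_div_iff₀ hm]; linarith
    simp only [Real.smoothTransition.one_of_one_le this]
    ring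

/-! ### The terms of the relative entropy inequality -/

lemma Smooth.half_sqn {A : ℝ → X → X} (hA : NSK.Smooth A) :
    NSK.Smooth (fun t x => 1 / 2 * sqn (A t x)) :=
  (hA.dotProduct hA).const_mul _

/-- Pointwise, `½|A|²` tested in the continuity equation minus `A` tested in the momentum equation
of `ρa` gives the transport terms of the relative entropy. -/
lemma transport_identity {A : ℝ → X → X} (hA : NSK.Smooth A) (s : ℝ) (u a : X) (t : ℝ) (x : X) :
    s * (dt A t x ⬝ᵥ (A t x - a) + (jac (A t) x *ᵥ u) ⬝ᵥ (A t x - a)) =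
      (s * dt (fun s y => 1 / 2 * sqn (A s y)) t x
          + s * (u ⬝ᵥ grad (fun y => 1 / 2 * sqn (A t y)) x))
        - (s * (a ⬝ᵥ dt A t x)
          + s * colon (Matrix.vecMulVec a u) (jac (A t) x)) := by
  have hsq : NSK.Smooth (fun t x => sqn (A t x)) := hA.dotProduct hA
  have h1 : dt (fun s y => 1 / 2 * sqn (A s y)) t x = dt A t x ⬝ᵥ A t x := by
    have := ((hsq.hasDerivAt_dt t x).const_mul (1 / 2 : ℝ)).deriv
    rw [hA.dt_sqn] at this
    exact this.trans (by ring)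
  have h2 : ∀ j, grad (fun y => 1 / 2 * sqn (A t y)) x j = ∑ i, jac (A t) x i j * A t x i := by
    intro j
    have := ((hsq.differentiableAt_slice t x).hasFDerivAt.const_mul (1 / 2 : ℝ)).fderiv
    have h3 : pd j (fun y => 1 / 2 * sqn (A t y)) x = 1 / 2 * pd j (fun y => sqn (A t y)) x :=
      congrArg (fun L : X →L[ℝ] ℝ => L (Pi.single j 1)) this
    rw [grad, h3, hA.pd_sqn]
    ring
  rw [h1]
  simp only [dotProduct, Matrix.mulVec, colon, Matrix.vecMulVec_apply, h2, Fin.sum_univ_three,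
    Pi.sub_apply]
  ring

namespace IsWeakSolution

variable {ν κ γ T τ : ℝ} {H : ℝ → ℝ} {S : Fields}

lemma stInt_continuity (hS : IsWeakSolution ν κ γ H T S) (hτ : τ ∈ Icc 0 T) {φ : ℝ → X → ℝ}
    (hφ : NSK.Smooth φ) :
    stInt τ (fun t x => S.ρ t x * dt φ t x + S.ρ t x * (S.u t x ⬝ᵥ grad (φ t) x)) =
      spaceInt (fun x => S.ρ τ x * φ τ x) - spaceInt (fun x => S.ρ 0 x * φ 0 x) := by
  linarith [hS.continuity φ hφ τ hτ]

lemma stInt_relative_transport (hS : IsWeakSolution ν κ γ H T S) (hτ : τ ∈ Icc 0 T)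
    {a A : ℝ → X → X} (hA : NSK.Smooth A)
    (ha : ∀ i, MemLp (fun z : ℝ × X => √(S.ρ z.1 z.2) * a z.1 z.2 i) 2 (slab T)) :
    stInt τ (fun t x => S.ρ t x *
        (dt A t x ⬝ᵥ (A t x - a t x) + (jac (A t) x *ᵥ S.u t x) ⬝ᵥ (A t x - a t x))) =
      spaceInt (fun x => S.ρ τ x * (1 / 2 * sqn (A τ x)))
        - spaceInt (fun x => S.ρ 0 x * (1 / 2 * sqn (A 0 x)))
        - stInt τ (fun t x => S.ρ t x * (a t x ⬝ᵥ dt A t x)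
          + S.ρ t x * colon (Matrix.vecMulVec (a t x) (S.u t x)) (jac (A t) x)) := by
  rw [← hS.stInt_continuity hτ hA.half_sqn,
    ← stInt_sub hτ (hS.integrable_continuity hA.half_sqn) (hS.integrable_transport ha hA)]
  exact stInt_congr hτ fun t _ x => transport_identity hA _ _ _ _ _

lemma integrable_pressure_mul_dvg (hS : IsWeakSolution ν κ γ H T S) {A : ℝ → X → X}
    (hA : NSK.Smooth A) : IntegrableSlab T (fun t x => pressure γ (S.ρ t x) * dvg (A t) x) :=
  hS.integrable_pressure_slab.mul_smooth hA.dvg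

lemma stInt_transport_w (hS : IsWeakSolution ν κ γ H T S) (hτ : τ ∈ Icc 0 T) {W : ℝ → X → X}
    (hW : NSK.Smooth W) :
    stInt τ (fun t x => S.ρ t x * (S.w t x ⬝ᵥ dt W t x)
          + S.ρ t x * colon (Matrix.vecMulVec (S.w t x) (S.u t x)) (jac (W t) x)) =
      spaceInt (fun x => S.ρ τ x * (S.w τ x ⬝ᵥ W τ x))
        - spaceInt (fun x => S.ρ 0 x * (S.w 0 x ⬝ᵥ W 0 x))
        - stInt τ (fun t x => pressure γ (S.ρ t x) * dvg (W t) x)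
        + 2 * ν * stInt τ (fun t x => √(S.ρ t x) * colon (S.Tw t x) (jac (W t) x))
        - 2 * ν * stInt τ (fun t x => √(S.ρ t x) * colon (S.Tv t x) (jac (W t) x))
        - 2 * κ ^ 2 * stInt τ (S.capillary W) := by
  have h := hS.momentum_w W hW τ hτ
  have i1 := hS.integrable_transport hS.memLp_sqrt_w hW
  have i2 := hS.integrable_pressure_mul_dvg hW
  have i3 := (IntegrableSlab.mul_colon_jac hS.tensor_w.integrable hW).const_mul (2 * ν)
  have i4 := (IntegrableSlab.mul_colon_jac hS.tensor_v.integrable hW).const_mul (2 * ν)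
  rw [stInt_add hτ ((i1.add i2).sub i3) i4, stInt_sub hτ (i1.add i2) i3, stInt_add hτ i1 i2,
    stInt_const_mul, stInt_const_mul] at h
  linarith

lemma stInt_transport_v (hS : IsWeakSolution ν κ γ H T S) (hτ : τ ∈ Icc 0 T) {V : ℝ → X → X}
    (hV : NSK.Smooth V) :
    stInt τ (fun t x => S.ρ t x * (S.v t x ⬝ᵥ dt V t x)
          + S.ρ t x * colon (Matrix.vecMulVec (S.v t x) (S.u t x)) (jac (V t) x)) =
      spaceInt (fun x => S.ρ τ x * (S.v τ x ⬝ᵥ V τ x))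
        - spaceInt (fun x => S.ρ 0 x * (S.v 0 x ⬝ᵥ V 0 x))
        + 2 * ν * stInt τ (fun t x => √(S.ρ t x) * colon (S.Tv t x)ᵀ (jac (V t) x))
        - 2 * ν * stInt τ (fun t x => √(S.ρ t x) * colon (S.Tw t x)ᵀ (jac (V t) x)) := by
  have h := hS.momentum_v V hV τ hτ
  have i1 := hS.integrable_transport hS.memLp_sqrt_v hV
  have i3 := (IntegrableSlab.mul_colon_jac (A := fun t x => (S.Tv t x)ᵀ)
    (fun i j => hS.tensor_v.integrable j i) hV).const_mul (2 * ν)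
  have i4 := (IntegrableSlab.mul_colon_jac (A := fun t x => (S.Tw t x)ᵀ)
    (fun i j => hS.tensor_w.integrable j i) hV).const_mul (2 * ν)
  rw [stInt_add hτ (i1.sub i3) i4, stInt_sub hτ i1 i3, stInt_const_mul, stInt_const_mul] at h
  linarith

lemma stInt_viscous (hS : IsWeakSolution ν κ γ H T S) (hτ : τ ∈ Icc 0 T) {V W : ℝ → X → X}
    (hV : NSK.Smooth V) (hW : NSK.Smooth W) :
    stInt τ (fun t x => √(S.ρ t x) *
          (colon (S.Tv t x)ᵀ (jac (V t) x) + colon (S.Tw t x) (jac (W t) x))) =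
        stInt τ (fun t x => √(S.ρ t x) * colon (S.Tv t x)ᵀ (jac (V t) x))
          + stInt τ (fun t x => √(S.ρ t x) * colon (S.Tw t x) (jac (W t) x)) ∧
    stInt τ (fun t x => √(S.ρ t x) *
          (colon (S.Tv t x) (jac (W t) x) + colon (S.Tw t x)ᵀ (jac (V t) x))) =
        stInt τ (fun t x => √(S.ρ t x) * colon (S.Tv t x) (jac (W t) x))
          + stInt τ (fun t x => √(S.ρ t x) * colon (S.Tw t x)ᵀ (jac (V t) x)) := by
  simp only [mul_add]
  exact ⟨stInt_add hτ
      (IntegrableSlab.mul_colon_jac (A := fun t x => (S.Tv t x)ᵀ)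
        (fun i j => hS.tensor_v.integrable j i) hV)
      (IntegrableSlab.mul_colon_jac hS.tensor_w.integrable hW),
    stInt_add hτ (IntegrableSlab.mul_colon_jac hS.tensor_v.integrable hW)
      (IntegrableSlab.mul_colon_jac (A := fun t x => (S.Tw t x)ᵀ)
        (fun i j => hS.tensor_w.integrable j i) hV)⟩

lemma stInt_capillary_reference (hS : IsWeakSolution ν κ γ H T S) (hτ : τ ∈ Icc 0 T)
    {r : ℝ → X → ℝ} (hr : NSK.Smooth r) :
    stInt τ (fun t x => S.ρ t x * dt (fun s => lap (r s)) t x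
          + S.ρ t x * (S.u t x ⬝ᵥ grad (lap (r t)) x) - dt r t x * lap (r t) x) =
      spaceInt (fun x => S.ρ τ x * lap (r τ) x) - spaceInt (fun x => S.ρ 0 x * lap (r 0) x)
        + 1 / 2 * spaceInt (fun x => sqn (grad (r τ) x))
        - 1 / 2 * spaceInt (fun x => sqn (grad (r 0) x)) := by
  rw [stInt_sub hτ (hS.integrable_continuity hr.lap) ((hr.dt.mul hr.lap).integrableSlab T),
    hS.stInt_continuity hτ hr.lap]
  linarith [stInt_dt_mul_lap hr (τ := τ)]

lemma stInt_pressure_reference (hγ : 1 < γ) (hH : IsPressurePotential γ H)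
    (hS : IsWeakSolution ν κ γ H T S) (hτ : τ ∈ Icc 0 T)
    {r : ℝ → X → ℝ} {W : ℝ → X → X} (hr : NSK.Smooth r) (hW : NSK.Smooth W)
    (hpos : ∀ t ∈ Icc 0 T, ∀ x, 0 < r t x) :
    stInt τ (fun t x => dt (fun s y => deriv H (r s y)) t x * (S.ρ t x - r t x)
          + S.ρ t x * (S.u t x ⬝ᵥ grad (fun y => deriv H (r t y)) x)
          + pressure γ (S.ρ t x) * dvg (W t) x) =
      spaceInt (fun x => S.ρ τ x * deriv H (r τ x)) - spaceInt (fun x => S.ρ 0 x * deriv H (r 0 x))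
        - spaceInt (fun x => deriv H (r τ x) * r τ x - H (r τ x))
        + spaceInt (fun x => deriv H (r 0 x) * r 0 x - H (r 0 x))
        + stInt τ (fun t x => pressure γ (S.ρ t x) * dvg (W t) x) := by
  obtain ⟨q, hq, hq0, hqr⟩ := hr.exists_pos_extension hpos
  have hqr' : ∀ t ∈ Icc 0 T, q t = r t := fun t ht =>
    funext fun x => (hqr t ht x).self_of_nhds
  have hφ : NSK.Smooth (fun t x => deriv H (q t x)) := hq.comp (hH.contDiffOn_deriv hγ) hq0
  have hK : NSK.Smooth (fun t x => deriv H (q t x) * q t x - H (q t x)) :=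
    (hφ.mul hq).sub (hq.comp (hH.contDiffOn hγ) hq0)
  have hdK : ∀ t x, dt (fun t x => deriv H (q t x) * q t x - H (q t x)) t x =
      dt (fun t x => deriv H (q t x)) t x * q t x := by
    intro t x
    have h1 := hφ.hasDerivAt_dt t x
    have h2 := hq.hasDerivAt_dt t x
    have h3 : HasDerivAt (fun s => H (q s x)) (deriv H (q t x) * dt q t x) t :=
      (hH.differentiableAt _ (hq0 t x)).hasDerivAt.comp t h2
    exact ((h1.mul h2).sub h3).deriv.trans (by ring)
  -- At `t = 0` and `t = T` the derivative is two-sided, so agreement on `[0,T]` would not suffice.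
  have hdt : ∀ t ∈ Icc 0 T, ∀ x, dt (fun s y => deriv H (r s y)) t x =
      dt (fun s y => deriv H (q s y)) t x := by
    intro t ht x
    refine Filter.EventuallyEq.deriv_eq ?_
    have hc : Filter.Tendsto (fun s : ℝ => ((s, x) : ℝ × X)) (nhds t) (nhds (t, x)) :=
      (Continuous.prodMk_left x).continuousAt
    filter_upwards [hc.eventually (hqr t ht x)] with s hs
    exact congrArg (deriv H) hs.symm
  have h0 : (0 : ℝ) ∈ Icc 0 T := ⟨le_rfl, hτ.1.trans hτ.2⟩
  have hc := hS.stInt_continuity hτ hφ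
  have hk := stInt_dt hK (τ := τ)
  rw [← hqr' τ hτ, ← hqr' 0 h0]
  rw [stInt_congr hτ (fun t _ x => hdK t x)] at hk
  have i1 := hS.integrable_continuity hφ
  have i2 := (hφ.dt.mul hq).integrableSlab T
  have i3 := hS.integrable_pressure_mul_dvg hW
  have key : stInt τ (fun t x => dt (fun s y => deriv H (r s y)) t x * (S.ρ t x - r t x)
          + S.ρ t x * (S.u t x ⬝ᵥ grad (fun y => deriv H (r t y)) x)
          + pressure γ (S.ρ t x) * dvg (W t) x) = _ :=
    (stInt_congr hτ fun t ht x => by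
      simp only [hdt t ht x, hqr' t ht]
      ring).trans (stInt_add hτ (i1.sub i2) i3)
  rw [key, stInt_sub hτ i1 i2, hc, hk]
  ring

lemma spaceInt_gradρ_dotProduct (hS : IsWeakSolution ν κ γ H T S) {t : ℝ} (ht : t ∈ Icc 0 T)
    {r : ℝ → X → ℝ} (hr : NSK.Smooth r) :
    Integrable (fun x => S.gradρ t x ⬝ᵥ grad (r t) x) torusMeasure ∧
    spaceInt (fun x => S.gradρ t x ⬝ᵥ grad (r t) x) =
      - spaceInt (fun x => S.ρ t x * lap (r t) x) := by
  have hi : ∀ i, Integrable (fun x => S.gradρ t x i * pd i (r t) x) torusMeasure := fun i => by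
    obtain ⟨C, hC⟩ := (isCompact_Icc (a := (0 : X)) (b := 1)).exists_bound_of_continuousOn
      ((hr.pd i).continuous_slice t).continuousOn
    exact ((hS.weakGrad t ht).integrable_grad i).mul_bdd (c := C)
      ((hr.pd i).continuous_slice t).aestronglyMeasurable
      ((ae_restrict_mem measurableSet_Icc).mono hC)
  have h := fun i => (hS.weakGrad t ht).weak (pd i (r t)) ((hr.pd i).contDiff_slice t)
    ((hr.pd i).periodic t) i
  refine ⟨integrable_finsetSum _ fun i _ => hi i, ?_⟩
  simp only [spaceInt, dotProduct, grad, lap, Finset.mul_sum] at h ⊢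
  rw [integral_finsetSum _ fun i _ => hi i, integral_finsetSum _ fun i _ =>
    hS.integrable_slice_ρ_smooth ht (((hr.pd i).pd i).continuous_slice t),
    ← Finset.sum_neg_distrib]
  exact Finset.sum_congr rfl fun i _ => by rw [h i, neg_neg]

/-- The relative entropy is the energy plus terms that are affine in `ρ`, `ρw`, `ρv`. -/
lemma relEntropy_eq (hγ : 1 < γ) (hH : IsPressurePotential γ H)
    (hS : IsWeakSolution ν κ γ H T S) {t : ℝ} (ht : t ∈ Icc 0 T)
    {r : ℝ → X → ℝ} {W V : ℝ → X → X} (hr : NSK.Smooth r) (hW : NSK.Smooth W) (hV : NSK.Smooth V)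
    (hpos : ∀ x, 0 < r t x) :
    S.relEntropy κ H r W V t = S.energy κ H t
      - spaceInt (fun x => S.ρ t x * (S.w t x ⬝ᵥ W t x))
      - spaceInt (fun x => S.ρ t x * (S.v t x ⬝ᵥ V t x))
      + spaceInt (fun x => S.ρ t x * (1 / 2 * sqn (W t x)))
      + spaceInt (fun x => S.ρ t x * (1 / 2 * sqn (V t x)))
      + 2 * κ ^ 2 * spaceInt (fun x => S.ρ t x * lap (r t) x)
      + κ ^ 2 * spaceInt (fun x => sqn (grad (r t) x))
      - spaceInt (fun x => S.ρ t x * deriv H (r t x))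
      + spaceInt (fun x => deriv H (r t x) * r t x - H (r t x)) := by
  have hw : ∀ i, MemLp (fun x => √(S.ρ t x) * S.w t x i) 2 torusMeasure := fun i => by
    obtain ⟨C, hC⟩ := hS.bound_w i; exact (hC t ht).1
  have hv : ∀ i, MemLp (fun x => √(S.ρ t x) * S.v t x i) 2 torusMeasure := fun i => by
    obtain ⟨C, hC⟩ := hS.bound_v i; exact (hC t ht).1
  obtain ⟨iw, iW⟩ := hS.integrable_slice_kinetic ht hw (hW.continuous_slice t)
  obtain ⟨iv, iV⟩ := hS.integrable_slice_kinetic ht hv (hV.continuous_slice t)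
  have iH := hS.integrable_slice_potential hγ hH ht
  have ig := hS.integrable_slice_sqn_gradρ ht
  obtain ⟨igr, hgr⟩ := hS.spaceInt_gradρ_dotProduct ht hr
  have iWW := hS.integrable_slice_ρ_smooth ht (hW.half_sqn.continuous_slice t)
  have iVV := hS.integrable_slice_ρ_smooth ht (hV.half_sqn.continuous_slice t)
  have irr : Integrable (fun x => sqn (grad (r t) x)) torusMeasure :=
    ((hr.grad.dotProduct hr.grad).continuous_slice t).integrable_torus
  have cH' : Continuous fun x => deriv H (r t x) :=
    (hH.contDiffOn_deriv hγ).continuousOn.comp_continuous (hr.continuous_slice t) hpos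
  have cH : Continuous fun x => H (r t x) :=
    (hH.contDiffOn hγ).continuousOn.comp_continuous (hr.continuous_slice t) hpos
  have iHr := hS.integrable_slice_ρ_smooth ht cH'
  have iK : Integrable (fun x => deriv H (r t x) * r t x - H (r t x)) torusMeasure :=
    ((cH'.mul (hr.continuous_slice t)).sub cH).integrable_torus
  have hE : S.energy κ H t = spaceInt (fun x => 1 / 2 * (S.ρ t x * sqn (S.w t x)
      + S.ρ t x * sqn (S.v t x)) + κ ^ 2 * sqn (S.gradρ t x))
      + spaceInt (fun x => H (S.ρ t x)) := by
    rw [← spaceInt_add (((iw.fun_add iv).const_mul (1 / 2)).fun_add (ig.const_mul (κ ^ 2))) iH]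
    exact spaceInt_congr fun x => by ring
  have hK : spaceInt (fun x => 1 / 2 * S.ρ t x * (sqn (S.w t x - W t x) + sqn (S.v t x - V t x))
        + κ ^ 2 * sqn (S.gradρ t x - grad (r t) x)) =
      spaceInt (fun x => 1 / 2 * (S.ρ t x * sqn (S.w t x) + S.ρ t x * sqn (S.v t x))
          + κ ^ 2 * sqn (S.gradρ t x))
        - spaceInt (fun x => S.ρ t x * (S.w t x ⬝ᵥ W t x))
        - spaceInt (fun x => S.ρ t x * (S.v t x ⬝ᵥ V t x))
        + spaceInt (fun x => S.ρ t x * (1 / 2 * sqn (W t x)))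
        + spaceInt (fun x => S.ρ t x * (1 / 2 * sqn (V t x)))
        + (-(2 * κ ^ 2)) * spaceInt (fun x => S.gradρ t x ⬝ᵥ grad (r t) x)
        + κ ^ 2 * spaceInt (fun x => sqn (grad (r t) x)) := by
    have i1 := ((iw.fun_add iv).const_mul (1 / 2)).fun_add (ig.const_mul (κ ^ 2))
    rw [← spaceInt_sub i1 iW, ← spaceInt_sub (i1.sub' iW) iV,
      ← spaceInt_add ((i1.sub' iW).sub' iV) iWW,
      ← spaceInt_add (((i1.sub' iW).sub' iV).fun_add iWW) iVV,
      ← spaceInt_const_mul, ← spaceInt_const_mul,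
      ← spaceInt_add ((((i1.sub' iW).sub' iV).fun_add iWW).fun_add iVV) (igr.const_mul _),
      ← spaceInt_add (((((i1.sub' iW).sub' iV).fun_add iWW).fun_add iVV).fun_add (igr.const_mul _))
        (irr.const_mul _)]
    refine spaceInt_congr fun x => ?_
    simp only [sqn, sub_dotProduct, dotProduct_sub, dotProduct_comm (W t x) (S.w t x),
      dotProduct_comm (V t x) (S.v t x), dotProduct_comm (grad (r t) x) (S.gradρ t x)]
    ring
  have hP : spaceInt (fun x => relPotential H (S.ρ t x) (r t x)) =
      spaceInt (fun x => H (S.ρ t x)) - spaceInt (fun x => S.ρ t x * deriv H (r t x))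
        + spaceInt (fun x => deriv H (r t x) * r t x - H (r t x)) := by
    rw [← spaceInt_sub iH iHr, ← spaceInt_add (iH.sub' iHr) iK]
    exact spaceInt_congr fun x => by unfold relPotential; ring
  rw [Fields.relEntropy, hK, hP, hE, hgr]
  ring

end IsWeakSolution

end NSK

theorem theorem3p1 (ν κ γ T : ℝ) (hν : 0 < ν) (hκ : 0 < κ) (hγ : 1 < γ) (hT : 0 < T)
    (H : ℝ → ℝ) (hH : IsPressurePotential γ H)
    (S : Fields) (hS : IsWeakSolution ν κ γ H T S)
    (r : ℝ → X → ℝ) (W V : ℝ → X → X)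
    (hr : NSK.Smooth r) (hW : NSK.Smooth W) (hV : NSK.Smooth V)
    (hr_pos : ∀ t ∈ Set.Icc 0 T, ∀ x, 0 < r t x)
    (τ : ℝ) (hτ : τ ∈ Set.Icc 0 T) :
    S.relEntropy κ H r W V τ - S.relEntropy κ H r W V 0 ≤
      stInt τ (fun t x => S.ρ t x *
        (dt V t x ⬝ᵥ (V t x - S.v t x) + (jac (V t) x *ᵥ S.u t x) ⬝ᵥ (V t x - S.v t x)))
      + stInt τ (fun t x => S.ρ t x *
        (dt W t x ⬝ᵥ (W t x - S.w t x) + (jac (W t) x *ᵥ S.u t x) ⬝ᵥ (W t x - S.w t x)))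
      + 2 * κ ^ 2 * stInt τ (fun t x =>
          S.ρ t x * dt (fun s => lap (r s)) t x
          + S.ρ t x * (S.u t x ⬝ᵥ grad (lap (r t)) x)
          - dt r t x * lap (r t) x)
      - 2 * κ ^ 2 * stInt τ (S.capillary W)
      + 2 * ν * stInt τ (fun t x => √(S.ρ t x) *
          (colon (S.Tv t x)ᵀ (jac (V t) x) + colon (S.Tw t x) (jac (W t) x)))
      - 2 * ν * stInt τ (fun t x => √(S.ρ t x) *
          (colon (S.Tv t x) (jac (W t) x) + colon (S.Tw t x)ᵀ (jac (V t) x)))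
      - stInt τ (fun t x =>
          dt (fun s y => deriv H (r s y)) t x * (S.ρ t x - r t x)
          + S.ρ t x * (S.u t x ⬝ᵥ grad (fun y => deriv H (r t y)) x)
          + pressure γ (S.ρ t x) * dvg (W t) x)
      - 2 * ν * stInt τ (S.viscousDissipation γ)
      - 4 * ν * κ ^ 2 * stInt τ (fun t x => S.lapρ t x ^ 2) := by
  have h0 : (0 : ℝ) ∈ Icc 0 T := ⟨le_rfl, hT.le⟩
  rw [hS.relEntropy_eq hγ hH hτ hr hW hV (hr_pos τ hτ),
    hS.relEntropy_eq hγ hH h0 hr hW hV (hr_pos 0 h0),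
    hS.stInt_relative_transport hτ hV hS.memLp_sqrt_v,
    hS.stInt_relative_transport hτ hW hS.memLp_sqrt_w,
    hS.stInt_transport_v hτ hV, hS.stInt_transport_w hτ hW,
    hS.stInt_capillary_reference hτ hr, (hS.stInt_viscous hτ hV hW).1,
    (hS.stInt_viscous hτ hV hW).2, hS.stInt_pressure_reference hγ hH hτ hr hW hr_pos]
  linarith [hS.energy_ineq τ hτ]
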